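/- \textbf{Setting.} All sets $\Theta$ (types), $T$ (tests), $X$ (decisions), $M$ (messages) below are Polish spaces with their Borel $\sigma$-algebras, and $\Delta(Z)$ denotes the Borel probability measures on $Z$. A map $k\colon Y\to\Delta(Z)$ is always assumed universally measurable: for each Borel $B\subseteq Z$, $y\mapsto k_y(B)$ is measurable with respect to the universal completion of the Borel $\sigma$-algebra of $Y$ (the intersection of its completions under all Borel probability measures). A \emph{testing environment} consists of $T$ and a Borel passage rate $\pi\colon T\times\Theta\to[0,1]$, where $\pi(\tau|\theta)$ is the probability that type $\theta$ passes test $\tau$ if he exerts effort; without effort the result is $0$ (fail) for sure. Write $\pi_{\tau|\theta}$ for the measure on $\{0,1\}$ putting probability $\pi(\tau|\theta)$ on $1$. A \emph{decision environment} consists of $X$ and a Borel utility function $u\colon X\times\Theta\to\mathbf R$. A \emph{mechanism} $(M,t,g)$ consists of a message space $M$, a testing rule $t\colon M\to\Delta(T)$ and a decision rule $g\colon M\times T\times\{0,1\}\to\Delta(X)$. A \emph{strategy} $(r,e)$ consists of $r\colon\Theta\to\Delta(M)$ and a universally measurable effort function $e\colon\Theta\times M\times T\to[0,1]$. Together they induce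 the social choice function $\Theta\to\Delta(X)$ under which type $\theta$ draws $m\sim r_\theta$, then $\tau\sim t_m$, then the score $s\in\{0,1\}$ with $s=1$ having probability $e(\theta,m,\tau)\pi(\tau|\theta)$, then the decision from $g_{m,\tau,s}$. The profile $(M,t,g;r,e)$ is \emph{incentive compatible} if every strategy gives every type a well-defined expected utility in $[-\infty,\infty]$ and, for each type, $(r,e)$ maximizes that type's expected utility over all strategies. It \emph{implements} $f\colon\Theta\to\Delta(X)$ if it is incentive compatible and induces $f$; $f$ is \emph{implementable} if some profile implements it. Given $\hat t\colon\Theta\to\Delta(T)$, $f$ is \emph{canonically implementable with $\hat t$} if there are a decision rule $g\colon \Theta\times T\times\{0,1\}\to\Delta(X)$ and a strategy $(r,e)$ with $r_\theta=\delta_\theta$ and $e(\theta,\theta,\tau)=1$ for all $\theta,\tau$ such that $(\Theta,\hat t,g;r,e)$ implements $f$. A function $\hat t\colon\Theta\to T$ is identified with $\theta\mapsto\delta_{\hat t(\theta)}$. For a type $\theta$ and tests $\tau,\psi$, write $\tau\succeq_\theta\psi$ if there is a Markov transition $k$ on $\{0,1\}$ that is monotone ($k_1$ first-order stochastically dominates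 $k_0$) such that (i) $\pi_{\tau|\theta}k=\pi_{\psi|\theta}$ and (ii) $\pi_{\tau|\theta'}k$ is first-order stochastically dominated by $\pi_{\psi|\theta'}$ for all $\theta'\neq\theta$. A function $\hat t\colon\Theta\to T$ is \emph{most discerning} if $\hat t(\theta)\succeq_\theta\psi$ for all $\theta\in\Theta$ and $\psi\in T$. \textbf{Theorem (Most-discerning implementation).} Fix a type space $\Theta$ and a testing environment $(T,\pi)$. For a Borel measurable testing function $\hat t\colon\Theta\to T$, the following are equivalent. \begin{enumerate} \item $\hat t$ is most discerning. \item In every decision environment $(X,u)$, every implementable social choice function is canonically implementable with $\hat t$. \end{enumerate} -/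

import Mathlib

open MeasureTheory

universe u v

namespace MechTest

/-! ### Universal measurability and Markov transitions -/

/-- The universal completion of the given σ-algebra: the sets that lie in the completion with
respect to every probability measure. (`NullMeasurableSet A μ` says that `A` belongs to the
`μ`-completion of the σ-algebra.) -/
abbrev universalCompletion (X : Type*) [MeasurableSpace X] : MeasurableSpace X where
  MeasurableSet' A := ∀ μ : Measure X, IsProbabilityMeasure μ → NullMeasurableSet A μ
  measurableSet_empty := fun _ _ => MeasurableSet.empty.nullMeasurableSet
  measurableSet_compl := fun _ h μ hμ => (h μ hμ).compl
  measurableSet_iUnion := fun _ h μ hμ => NullMeasurableSet.iUnion fun i => h i μ hμ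

/-- A function is universally measurable if it is measurable from the universal completion of the
σ-algebra of the domain. -/
def UnivMeasurable {X Y : Type*} [MeasurableSpace X] [MeasurableSpace Y] (f : X → Y) : Prop :=
  @Measurable X Y (universalCompletion X) _ f

/-- Universally measurable Markov transitions `X → Δ(Y)`. Each `k x` is a probability measure on the
given σ-algebra of `Y` (identified with its unique extension to the universal completion), and
`x ↦ k x B` is universally measurable for each measurable `B`. -/
@[ext]
structure MarkovTransition (X Y : Type*) [MeasurableSpace X] [MeasurableSpace Y] where
  toFun : X → Measure Y
  isProb : ∀ x, IsProbabilityMeasure (toFun x)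
  univMeasurable : ∀ B : Set Y, MeasurableSet B → UnivMeasurable fun x => toFun x B

instance {X Y : Type*} [MeasurableSpace X] [MeasurableSpace Y] :
    CoeFun (MarkovTransition X Y) fun _ => X → Measure Y := ⟨MarkovTransition.toFun⟩

instance {X Y : Type*} [MeasurableSpace X] [MeasurableSpace Y] (k : MarkovTransition X Y) (x : X) :
    IsProbabilityMeasure (k x) := k.isProb x

section Facts

variable {X Y Z : Type*} [MeasurableSpace X] [MeasurableSpace Y] [MeasurableSpace Z]

theorem le_universalCompletion : ‹MeasurableSpace X› ≤ universalCompletion X :=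
  fun _ h _ _ => h.nullMeasurableSet

theorem univMeasurable_of_measurable {f : X → Y} (hf : Measurable f) : UnivMeasurable f :=
  hf.mono le_universalCompletion le_rfl

theorem UnivMeasurable.comp_measurable {f : Y → Z} (hf : UnivMeasurable f) {φ : X → Y}
    (hφ : Measurable φ) : UnivMeasurable fun x => f (φ x) := by
  intro s hs μ hμ
  have h := hf hs (μ.map φ) (Measure.isProbabilityMeasure_map hφ.aemeasurable)
  exact h.preimage (hφ.quasiMeasurePreserving μ)

theorem UnivMeasurable.aemeasurable [MeasurableSpace.CountablyGenerated Y] {f : X → Y}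
    (hf : UnivMeasurable f) (μ : Measure X) [IsProbabilityMeasure μ] : AEMeasurable f μ :=
  NullMeasurable.aemeasurable fun _ hs => hf hs μ inferInstance

theorem univMeasurable_of_aemeasurable {f : X → Y}
    (hf : ∀ μ : Measure X, IsProbabilityMeasure μ → AEMeasurable f μ) : UnivMeasurable f :=
  fun _ hs μ hμ => (hf μ hμ).nullMeasurable hs

theorem MarkovTransition.exists_kernel [MeasurableSpace.CountablyGenerated Y]
    (k : MarkovTransition X Y) (μ : Measure X) [IsProbabilityMeasure μ] :
    ∃ κ : X → Measure Y, Measurable κ ∧ (∀ x, IsProbabilityMeasure (κ x)) ∧ ∀ᵐ x ∂μ, k x = κ x := by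
  classical
  let g := MeasurableSpace.natGeneratingSequence Y
  have hg : ∀ n, MeasurableSet (g n) := MeasurableSpace.measurableSet_natGeneratingSequence
  let G : Finset ℕ → Set Y := fun F => ⋂ i ∈ F, g i
  have hG : ∀ F, MeasurableSet (G F) := fun F => F.measurableSet_biInter fun i _ => hg i
  have hpi : IsPiSystem (Set.range G) := by
    rintro _ ⟨F, rfl⟩ _ ⟨F', rfl⟩ _
    exact ⟨F ∪ F', Finset.set_biInter_inter F F' g⟩
  have hgen : ‹MeasurableSpace Y› = MeasurableSpace.generateFrom (Set.range G) := by
    apply le_antisymm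
    · conv_lhs => rw [← MeasurableSpace.generateFrom_natGeneratingSequence Y]
      apply MeasurableSpace.generateFrom_mono
      rintro _ ⟨n, rfl⟩
      exact ⟨{n}, by simp [G, g]⟩
    · apply MeasurableSpace.generateFrom_le
      rintro _ ⟨F, rfl⟩
      exact hG F
  have hae : ∀ F, AEMeasurable (fun x => k x (G F)) μ := fun F =>
    (k.univMeasurable _ (hG F)).aemeasurable μ
  have hall : ∀ᵐ x ∂μ, ∀ F, k x (G F) = (hae F).mk _ x := ae_all_iff.2 fun F => (hae F).ae_eq_mk
  obtain ⟨A, hA, hAm, hA0⟩ := exists_measurable_superset_of_null (ae_iff.1 hall)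
  have hne : Nonempty X := nonempty_of_isProbabilityMeasure μ
  obtain ⟨x₀⟩ := hne
  let κ : X → Measure Y := fun x => if x ∈ A then k x₀ else k x
  have hκp : ∀ x, IsProbabilityMeasure (κ x) := fun x => by
    by_cases hx : x ∈ A
    · simp only [κ, hx, if_true]; infer_instance
    · simp only [κ, hx, if_false]; infer_instance
  refine ⟨κ, ?_, hκp, ?_⟩
  · refine Measurable.measure_of_isPiSystem_of_isProbabilityMeasure hgen hpi ?_
    rintro _ ⟨F, rfl⟩
    have : (fun x => κ x (G F)) = fun x => if x ∈ A then k x₀ (G F) else (hae F).mk _ x := by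
      funext x
      by_cases hx : x ∈ A
      · simp only [κ, hx, if_true]
      · simp only [κ, hx, if_false]
        by_contra hne
        exact hx (hA fun h => hne (h F))
    rw [this]
    exact Measurable.ite hAm measurable_const (hae F).measurable_mk
  · have : ∀ᵐ x ∂μ, x ∉ A := measure_eq_zero_iff_ae_notMem.1 hA0
    filter_upwards [this] with x hx
    simp only [κ, hx, if_false]

theorem MarkovTransition.aemeasurable [MeasurableSpace.CountablyGenerated Y]
    (k : MarkovTransition X Y) (μ : Measure X) [IsProbabilityMeasure μ] :
    AEMeasurable k.toFun μ := by
  obtain ⟨κ, hκ, -, h⟩ := k.exists_kernel μ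
  exact ⟨κ, hκ, h⟩

theorem univMeasurable_lintegral [MeasurableSpace.CountablyGenerated Y]
    (k : MarkovTransition X Y) {h : X × Y → ENNReal} (hh : UnivMeasurable h) :
    UnivMeasurable fun x => ∫⁻ y, h (x, y) ∂(k x) := by
  refine univMeasurable_of_aemeasurable fun μ hμ => ?_
  obtain ⟨κ, hκ, hκp, hk⟩ := k.exists_kernel μ
  let K : ProbabilityTheory.Kernel X Y := ⟨κ, hκ⟩
  have : ProbabilityTheory.IsMarkovKernel K := ⟨hκp⟩
  have hae : AEMeasurable h (μ.compProd K) := hh.aemeasurable _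
  have h2 := Measure.ae_ae_of_ae_compProd hae.ae_eq_mk
  refine ⟨fun x => ∫⁻ y, hae.mk h (x, y) ∂(K x),
    Measurable.lintegral_kernel_prod_right' (κ := K) hae.measurable_mk, ?_⟩
  filter_upwards [hk, h2] with x hx hx2
  rw [hx]
  exact lintegral_congr_ae hx2

end Facts

/-- The transition `x ↦ k (φ x)`, for measurable `φ`. -/
def MarkovTransition.comap {X Y Z : Type*} [MeasurableSpace X] [MeasurableSpace Y]
    [MeasurableSpace Z] (k : MarkovTransition Y Z) (φ : X → Y) (hφ : Measurable φ) :
    MarkovTransition X Z where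
  toFun x := k (φ x)
  isProb x := k.isProb (φ x)
  univMeasurable B hB := (k.univMeasurable B hB).comp_measurable hφ

/-- The deterministic transition `x ↦ δ_{φ x}`, for measurable `φ`. -/
noncomputable def MarkovTransition.deterministic {X Y : Type*} [MeasurableSpace X]
    [MeasurableSpace Y] (φ : X → Y) (hφ : Measurable φ) : MarkovTransition X Y where
  toFun x := Measure.dirac (φ x)
  isProb _ := Measure.dirac.isProbabilityMeasure
  univMeasurable _ hB := univMeasurable_of_measurable
    ((Measure.measurable_coe hB).comp (Measure.measurable_dirac.comp hφ))

/-- Sequential composition: draw `y` from `k x`, then draw from `l (x, y)`. See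
`MarkovTransition.andThen_apply`. -/
noncomputable def MarkovTransition.andThen {X Y Z : Type*} [MeasurableSpace X] [MeasurableSpace Y]
    [MeasurableSpace Z] [MeasurableSpace.CountablyGenerated Y]
    [MeasurableSpace.CountablyGenerated Z]
    (k : MarkovTransition X Y) (l : MarkovTransition (X × Y) Z) : MarkovTransition X Z where
  toFun x := (k x).bind fun y => l (x, y)
  isProb x := isProbabilityMeasure_bind
    ((l.comap (Prod.mk x) measurable_prodMk_left).aemeasurable (k x))
    (Filter.Eventually.of_forall fun y => l.isProb (x, y))
  univMeasurable B hB := by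
    have : (fun x => (k x).bind (fun y => l (x, y)) B) = fun x => ∫⁻ y, l (x, y) B ∂(k x) := by
      funext x
      exact Measure.bind_apply hB
        ((l.comap (Prod.mk x) measurable_prodMk_left).aemeasurable (k x))
    rw [this]
    exact univMeasurable_lintegral k (l.univMeasurable B hB)

theorem MarkovTransition.andThen_apply {X Y Z : Type*} [MeasurableSpace X] [MeasurableSpace Y]
    [MeasurableSpace Z] [MeasurableSpace.CountablyGenerated Y]
    [MeasurableSpace.CountablyGenerated Z]
    (k : MarkovTransition X Y) (l : MarkovTransition (X × Y) Z) (x : X) {B : Set Z}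
    (hB : MeasurableSet B) : k.andThen l x B = ∫⁻ y, l (x, y) B ∂(k x) :=
  Measure.bind_apply hB ((l.comap (Prod.mk x) measurable_prodMk_left).aemeasurable (k x))

/-! ### Tests, mechanisms, strategies -/

/-- A passage rate `π : T × Θ → [0,1]`; together with `T` it is a testing environment. -/
structure PassageRate (T Θ : Type*) [MeasurableSpace T] [MeasurableSpace Θ] where
  rate : T × Θ → unitInterval
  measurable : Measurable rate

/-- The distribution on scores `{0,1}` with passing probability `p`. The score `1` (pass) is `true`,
the score `0` (fail) is `false`. -/
noncomputable def scoreMeasure (p : unitInterval) : Measure Bool :=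
  ProbabilityTheory.bernoulliMeasure true false p

theorem measurable_scoreMeasure (B : Set Bool) : Measurable fun p => scoreMeasure p B := by
  classical
  have h0 : (fun p => scoreMeasure p B) = fun p => _ := funext fun p =>
    ProbabilityTheory.bernoulliMeasure_apply (x := true) (y := false) p
      (MeasurableSet.of_discrete (s := B))
  rw [h0]
  have h1 : Measurable fun p : unitInterval => ((unitInterval.toNNReal p : NNReal) : ENNReal) := by
    have : Continuous unitInterval.toNNReal := unitInterval.toNNReal_continuous
    fun_prop
  have h2 : Measurable fun p : unitInterval =>
      ((unitInterval.toNNReal (unitInterval.symm p) : NNReal) : ENNReal) :=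
    h1.comp unitInterval.continuous_symm.measurable
  split_ifs <;> first | exact h1 | exact h2 | exact measurable_const

/-- A mechanism `(M, t, g)`. -/
structure Mechanism (M T X : Type*) [MeasurableSpace M] [MeasurableSpace T]
    [MeasurableSpace X] where
  testingRule : MarkovTransition M T
  decisionRule : MarkovTransition (M × T × Bool) X

/-- A strategy `(r, e)`: a reporting strategy, and the probability of exerting effort for each type,
message sent and test observed. -/
structure Strategy (Θ M T : Type*) [MeasurableSpace Θ] [MeasurableSpace M]
    [MeasurableSpace T] where
  report : MarkovTransition Θ M
  effort : Θ × M × T → unitInterval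
  effort_univMeasurable : UnivMeasurable effort

section Play

variable {Θ T M X : Type*} [MeasurableSpace Θ] [MeasurableSpace T] [MeasurableSpace M]
  [MeasurableSpace X]

/-- The score distribution of type `θ` who sent `m` and was given `τ`: the score is `1` with
probability `e(θ, m, τ) π(τ | θ)`. -/
noncomputable def scoreTransition (P : PassageRate T Θ) (σ : Strategy Θ M T) :
    MarkovTransition (Θ × M × T) Bool where
  toFun h := scoreMeasure (σ.effort h * P.rate (h.2.2, h.1))
  isProb h := by unfold scoreMeasure; infer_instance
  univMeasurable B _ := by
    have hP : UnivMeasurable fun h : Θ × M × T => P.rate (h.2.2, h.1) :=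
      univMeasurable_of_measurable (P.measurable.comp (by fun_prop))
    have hm : UnivMeasurable fun h : Θ × M × T => σ.effort h * P.rate (h.2.2, h.1) :=
      
      @Measurable.mul unitInterval _ _ _ (universalCompletion (Θ × M × T)) _ _ _
        σ.effort_univMeasurable hP
    exact (measurable_scoreMeasure B).comp hm

variable [MeasurableSpace.CountablyGenerated T] [MeasurableSpace.CountablyGenerated M]
  [MeasurableSpace.CountablyGenerated X]

/-- The social choice function `(r × t × (eπ)) g` induced by a profile: type `θ` draws a message
from `r θ`, the test is drawn from `t m`, the score from `e π`, and the decision from `g`. -/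
noncomputable def inducedSCF (P : PassageRate T Θ) (μ : Mechanism M T X) (σ : Strategy Θ M T) :
    MarkovTransition Θ X :=
  σ.report.andThen <|
    (μ.testingRule.comap (fun h : Θ × M => h.2) measurable_snd).andThen <|
      ((scoreTransition P σ).comap (fun h : (Θ × M) × T => (h.1.1, h.1.2, h.2))
        (by fun_prop)).andThen <|
        μ.decisionRule.comap (fun h : ((Θ × M) × T) × Bool => (h.1.1.2, h.1.2, h.2)) (by fun_prop)

/-- The induced social choice function as an iterated integral. -/
theorem inducedSCF_apply (P : PassageRate T Θ) (μ : Mechanism M T X) (σ : Strategy Θ M T) (θ : Θ)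
    {B : Set X} (hB : MeasurableSet B) :
    inducedSCF P μ σ θ B =
      ∫⁻ m, ∫⁻ τ, ∫⁻ s, μ.decisionRule (m, τ, s) B
        ∂(scoreMeasure (σ.effort (θ, m, τ) * P.rate (τ, θ))) ∂(μ.testingRule m) ∂(σ.report θ) := by
  unfold inducedSCF
  rw [MarkovTransition.andThen_apply _ _ _ hB]
  refine lintegral_congr fun m => ?_
  rw [MarkovTransition.andThen_apply _ _ _ hB]
  refine lintegral_congr fun τ => ?_
  rw [MarkovTransition.andThen_apply _ _ _ hB]
  rfl

end Play

/-! ### Incentives and implementation -/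

/-- A (Bernoulli) utility function `u : X × Θ → ℝ` of the agent; together with `X` it is a decision
environment. -/
structure Utility (X Θ : Type*) [MeasurableSpace X] [MeasurableSpace Θ] where
  val : X × Θ → ℝ
  measurable : Measurable val

section Incentives

variable {X Θ : Type*} [MeasurableSpace X] [MeasurableSpace Θ]

/-- The expectation of the positive part of the utility of type `θ` under a decision lottery. -/
noncomputable def Utility.gain (U : Utility X Θ) (θ : Θ) (ν : Measure X) : ENNReal :=
  ∫⁻ x, ENNReal.ofReal (U.val (x, θ)) ∂ν

/-- The expectation of the negative part of the utility of type `θ` under a decision lottery. -/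
noncomputable def Utility.loss (U : Utility X Θ) (θ : Θ) (ν : Measure X) : ENNReal :=
  ∫⁻ x, ENNReal.ofReal (-U.val (x, θ)) ∂ν

/-- The expected utility is well defined in `[-∞, ∞]`, i.e. it is not of the form `∞ - ∞`. -/
def Utility.WellDefined (U : Utility X Θ) (θ : Θ) (ν : Measure X) : Prop :=
  U.gain θ ν ≠ ⊤ ∨ U.loss θ ν ≠ ⊤

/-- Expected utility, meaningful under `Utility.WellDefined`. -/
noncomputable def Utility.expected (U : Utility X Θ) (θ : Θ) (ν : Measure X) : EReal :=
  (U.gain θ ν : EReal) - (U.loss θ ν : EReal)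

variable {T M : Type*} [MeasurableSpace T] [MeasurableSpace M]
  [MeasurableSpace.CountablyGenerated T] [MeasurableSpace.CountablyGenerated M]
  [MeasurableSpace.CountablyGenerated X]

/-- Incentive compatibility of a profile: every strategy gives every type a well-defined expected
utility, and `σ` maximizes the expected utility of each type over all strategies. -/
def IncentiveCompatible (P : PassageRate T Θ) (U : Utility X Θ) (μ : Mechanism M T X)
    (σ : Strategy Θ M T) : Prop :=
  ∀ (σ' : Strategy Θ M T) (θ : Θ),
    U.WellDefined θ (inducedSCF P μ σ' θ) ∧
      U.expected θ (inducedSCF P μ σ' θ) ≤ U.expected θ (inducedSCF P μ σ θ)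

/-- The profile implements the social choice function `f`. -/
def Implements (P : PassageRate T Θ) (U : Utility X Θ) (μ : Mechanism M T X)
    (σ : Strategy Θ M T) (f : MarkovTransition Θ X) : Prop :=
  IncentiveCompatible P U μ σ ∧ f = inducedSCF P μ σ

end Incentives

/-- `f` is implementable: some profile, with a Polish message space, implements it. -/
def Implementable {Θ : Type u} {T : Type v} {X : Type u} [MeasurableSpace Θ] [MeasurableSpace T]
    [MeasurableSpace X] [MeasurableSpace.CountablyGenerated T]
    [MeasurableSpace.CountablyGenerated X]
    (P : PassageRate T Θ) (U : Utility X Θ) (f : MarkovTransition Θ X) : Prop :=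
  ∃ (M : Type u) (_ : TopologicalSpace M) (_ : PolishSpace M) (_ : MeasurableSpace M)
    (_ : BorelSpace M) (μ : Mechanism M T X) (σ : Strategy Θ M T), Implements P U μ σ f

/-- The strategy part of a canonical profile (the message space being `Θ`): truthful reporting, and
effort on every test after the truthful report. -/
def IsCanonical {Θ T : Type*} [MeasurableSpace Θ] [MeasurableSpace T]
    (σ : Strategy Θ Θ T) : Prop :=
  σ.report = MarkovTransition.deterministic id measurable_id ∧
    ∀ (θ : Θ) (τ : T), σ.effort (θ, θ, τ) = 1

/-- `f` is canonically implementable with the testing rule `t`. -/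
def CanonicallyImplementableWith {Θ T X : Type*} [MeasurableSpace Θ] [MeasurableSpace T]
    [MeasurableSpace X] [MeasurableSpace.CountablyGenerated Θ]
    [MeasurableSpace.CountablyGenerated T] [MeasurableSpace.CountablyGenerated X]
    (P : PassageRate T Θ) (U : Utility X Θ) (t : MarkovTransition Θ T)
    (f : MarkovTransition Θ X) : Prop :=
  ∃ (g : MarkovTransition (Θ × T × Bool) X) (σ : Strategy Θ Θ T),
    IsCanonical σ ∧ Implements P U ⟨t, g⟩ σ f

/-! ### Discernment orders -/

/-- First-order stochastic dominance `μ ≥ ν` for score distributions: the cumulative distribution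
function of `μ` lies below that of `ν` (here `false < true`). -/
def StochDominates (μ ν : Measure Bool) : Prop :=
  ∀ s : Bool, μ (Set.Iic s) ≤ ν (Set.Iic s)

/-- A score conversion is monotone if a higher score is converted to a dominating distribution. -/
def IsMonotone (k : MarkovTransition Bool Bool) : Prop :=
  StochDominates (k true) (k false)

/-- `τ` is more `θ`-discerning than `ψ`. Here `Measure.bind` is the product `π_{τ|θ} k`. -/
def MoreDiscerning {T Θ : Type*} [MeasurableSpace T] [MeasurableSpace Θ] (P : PassageRate T Θ)
    (θ : Θ) (τ ψ : T) : Prop :=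
  ∃ k : MarkovTransition Bool Bool, IsMonotone k ∧
    (scoreMeasure (P.rate (τ, θ))).bind k = scoreMeasure (P.rate (ψ, θ)) ∧
    ∀ θ' : Θ, θ' ≠ θ →
      StochDominates (scoreMeasure (P.rate (ψ, θ'))) ((scoreMeasure (P.rate (τ, θ'))).bind k)

/-- The testing function `t` is most discerning. -/
def MostDiscerning {T Θ : Type*} [MeasurableSpace T] [MeasurableSpace Θ] (P : PassageRate T Θ)
    (t : Θ → T) : Prop :=
  ∀ (θ : Θ) (ψ : T), MoreDiscerning P θ (t θ) ψ

end MechTest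

/-!
Suppose first that `t` is most discerning and that the profile `(M, t₀, g; r, e)` implements `f`. The
canonical decision rule `simulatedRule` simulates that profile: after the report `θ`, it draws a
message and a test `ψ` as `θ` would, converts the score on `t θ` into a score on `ψ`, scales the
result by the effort that `θ` would have exerted, and decides as `g` does. By the first discernment
condition, truth and effort reproduce `f` (`inducedSCF_simulatedRule_of_isCanonical`). By monotonicity
and the second condition, no type that pretends to be `θ` is converted into a pass on `ψ` more often
than it could pass `ψ` itself, so the same decisions are available to it in the original mechanism
(`exists_strategy_inducedSCF_eq`); incentive compatibility is inherited, including the requirement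
that expected utilities be well defined. The effort of the mimicking strategy may depend on the
message and the test but not on the type that the agent pretended to be, and is therefore averaged
over it by a Radon-Nikodym density (`exists_measurable_conditional_mean`).

The simulation needs conversions that depend on `θ` and `ψ` in a universally measurable way
(`MostDiscerning.exists_univMeasurable_conversion`). A conversion that matches the passage rates of
`θ` is determined by its slope, the other types confine the slope to an interval, and the left
endpoint of that interval always works. It is a supremum of Borel functions over the Polish space of
types, hence universally measurable since analytic sets are
(`nullMeasurableSet_of_analyticSet`), a theorem of Lusin.

Conversely, let every type only want to pass, and consider the mechanism that always gives `ψ` and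
passes those who pass `ψ`. It implements the passage rate of `ψ`. If this is canonically
implementable with `t`, the decision rule at the report `θ` is a conversion of scores on `t θ`
into scores on `ψ`, and incentive compatibility is exactly the requirement that no other type gains
from it (`moreDiscerning_of_canonicallyImplementable`).
-/

namespace MechTest

/-! ### Analytic sets are universally measurable -/

section AnalyticSets

open Filter Topology Set

/-- If `b` bounds a box of sequences, the images of the boxes that constrain only the first `k`
coordinates shrink, up to closure, to the image of the full box. This is where compactness of the
full box enters. -/
theorem iInter_closure_image_box_subset {α : Type*} [TopologicalSpace α] [T2Space α]
    {f : (ℕ → ℕ) → α} (hf : Continuous f) (b : ℕ → ℕ) :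
    ⋂ k, closure (f '' {x | ∀ i < k, x i ≤ b i}) ⊆ f '' Iic b := by
  intro y hy
  by_contra hyK
  have hK : IsCompact (Iic b) := by
    have : Iic b = Set.pi univ fun i => Iic (b i) := by
      ext x; simp [Pi.le_def]
    rw [this]
    exact isCompact_univ_pi fun i => (finite_Iic (b i)).isCompact
  obtain ⟨V, U, hV, hU, hKV, hyU, hVU⟩ :=
    SeparatedNhds.of_isCompact_isCompact (hK.image hf) isCompact_singleton
      (disjoint_singleton_right.2 hyK)
  have hbox : ∀ k, ∃ x : ℕ → ℕ, (∀ i < k, x i ≤ b i) ∧ f x ∉ V := by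
    intro k
    obtain ⟨_, hz, x, hx, rfl⟩ := mem_closure_iff.1 (mem_iInter.1 hy k) U hU (hyU rfl)
    exact ⟨x, hx, fun h => disjoint_left.1 hVU h hz⟩
  choose x hxb hxV using hbox
  -- Truncating the sequences at `b` moves them into the compact box without changing limits.
  obtain ⟨z, hz, φ, hφ, hlim⟩ := hK.tendsto_subseq (x := fun k => x k ⊓ b)
    fun k => mem_Iic.2 inf_le_right
  have hlim' : Tendsto (x ∘ φ) atTop (𝓝 z) := by
    rw [tendsto_pi_nhds] at hlim ⊢
    intro i
    refine (hlim i).congr' ?_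
    filter_upwards [hφ.tendsto_atTop.eventually_gt_atTop i] with n hn
    simpa using hxb (φ n) i hn
  have hVz : f ⁻¹' V ∈ 𝓝 z := (hV.preimage hf).mem_nhds (hKV ⟨z, hz, rfl⟩)
  obtain ⟨n, hn⟩ := (hlim'.eventually hVz).exists
  exact hxV _ hn

/-- Inner approximation of analytic sets. The bounds `b k` are chosen one at a time so that the image
of the partial box keeps outer measure above `c`; this uses continuity from below of the outer
measure along arbitrary increasing unions. -/
theorem exists_isClosed_subset_range {α : Type*} [TopologicalSpace α] [T2Space α]
    [MeasurableSpace α] [OpensMeasurableSpace α] (μ : Measure α) [IsFiniteMeasure μ]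
    {f : (ℕ → ℕ) → α} (hf : Continuous f) {c : ENNReal} (hc : c < μ (range f)) :
    ∃ K ⊆ range f, IsClosed K ∧ c ≤ μ K := by
  have step : ∀ (k : ℕ) (S : {S : Set (ℕ → ℕ) // c < μ (f '' S)}),
      ∃ n : ℕ, c < μ (f '' (S.1 ∩ {x | x k ≤ n})) := by
    rintro k ⟨S, hS⟩
    have hU : f '' S = ⋃ n : ℕ, f '' (S ∩ {x | x k ≤ n}) := by
      rw [← image_iUnion, ← inter_iUnion]
      congr 1
      refine (inter_eq_left.2 fun x _ => mem_iUnion.2 ⟨x k, by simp⟩).symm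
    have hmono : Monotone fun n : ℕ => f '' (S ∩ {x | x k ≤ n}) := fun n m hnm =>
      image_mono (inter_subset_inter_right _ fun x (hx : x k ≤ n) => hx.trans hnm)
    rw [hU, hmono.measure_iUnion] at hS
    exact lt_iSup_iff.1 hS
  choose n hn using step
  let S : ℕ → {S : Set (ℕ → ℕ) // c < μ (f '' S)} := fun k =>
    k.rec ⟨univ, by simpa using hc⟩ fun k S => ⟨_, hn k S⟩
  let b : ℕ → ℕ := fun k => n k (S k)
  have hS : ∀ k, (S k).1 = {x | ∀ i < k, x i ≤ b i} := by
    intro k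
    induction k with
    | zero => simp [S]
    | succ k ih =>
      have : (S (k + 1)).1 = (S k).1 ∩ {x | x k ≤ b k} := rfl
      rw [this, ih]
      ext x
      simp only [mem_inter_iff, mem_ofPred_eq, Nat.lt_succ_iff_lt_or_eq]
      exact ⟨fun h i hi => hi.elim (h.1 i) fun e => e ▸ h.2,
        fun h => ⟨fun i hi => h i (.inl hi), h k (.inr rfl)⟩⟩
  let K : Set α := ⋂ k, closure (f '' {x | ∀ i < k, x i ≤ b i})
  refine ⟨K, (iInter_closure_image_box_subset hf b).trans (image_subset_range _ _),
    isClosed_iInter fun _ => isClosed_closure, ?_⟩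
  have hanti : Antitone fun k => closure (f '' {x | ∀ i < k, x i ≤ b i}) := fun k l hkl =>
    closure_mono (image_mono fun x hx i hi => hx i (hi.trans_le hkl))
  rw [hanti.measure_iInter (fun _ => isClosed_closure.measurableSet.nullMeasurableSet)
    ⟨0, measure_ne_top _ _⟩]
  refine le_iInf fun k => ?_
  have h := (S k).2
  rw [hS k] at h
  exact h.le.trans (measure_mono subset_closure)

/-- Analytic sets are universally measurable. -/
theorem nullMeasurableSet_of_analyticSet {α : Type*} [TopologicalSpace α] [T2Space α]
    [MeasurableSpace α] [OpensMeasurableSpace α] (μ : Measure α) [IsFiniteMeasure μ]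
    {A : Set α} (hA : AnalyticSet A) : NullMeasurableSet A μ := by
  rw [AnalyticSet] at hA
  rcases hA with rfl | ⟨f, hf, rfl⟩
  · exact nullMeasurableSet_empty
  rcases eq_or_ne (μ (range f)) 0 with h0 | h0
  · exact NullMeasurableSet.of_null h0
  obtain ⟨c, -, hcA, hc⟩ := exists_seq_strictMono_tendsto' (pos_iff_ne_zero.2 h0)
  choose K hKA hKc hK using fun n => exists_isClosed_subset_range μ hf (hcA n).2
  have hm : MeasurableSet (⋃ n, K n) := .iUnion fun n => (hKc n).measurableSet
  refine hm.nullMeasurableSet.congr (ae_eq_of_subset_of_measure_ge (iUnion_subset hKA)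
    (le_of_tendsto' hc fun n => (hK n).trans (measure_mono (subset_iUnion K n)))
    hm.nullMeasurableSet (measure_ne_top _ _))

/-- The supremum of a Borel family of functions indexed by a Polish space need not be Borel, but it
is universally measurable, because its strict upper level sets are projections of Borel sets. -/
theorem univMeasurable_iSup_of_polish {α β : Type*} [TopologicalSpace α] [PolishSpace α]
    [MeasurableSpace α] [BorelSpace α] [TopologicalSpace β] [PolishSpace β] [MeasurableSpace β]
    [BorelSpace β] [Nonempty β] {F : α × β → ℝ} (hF : Measurable F)
    (hbdd : ∀ x, BddAbove (range fun y => F (x, y))) :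
    UnivMeasurable fun x => ⨆ y, F (x, y) := by
  refine measurable_of_Ioi (mα := _) fun c => ?_
  have : (fun x => ⨆ y, F (x, y)) ⁻¹' Ioi c = Prod.fst '' (F ⁻¹' Ioi c) := by
    ext x
    simp only [mem_preimage, mem_Ioi, lt_ciSup_iff (hbdd x), mem_image, Prod.exists,
      exists_and_right, exists_eq_right]
  rw [this]
  intro μ hμ
  exact nullMeasurableSet_of_analyticSet μ
    ((hF measurableSet_Ioi).analyticSet.image_of_continuous continuous_fst)

end AnalyticSets

/-! ### Scores, mixtures and monotone conversions -/

/-- The mixture that gives `x` with probability `p` and `y` with probability `1 - p`. -/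
noncomputable def mix (p : ℝ) (x y : ENNReal) : ENNReal :=
  ENNReal.ofReal p * x + ENNReal.ofReal (1 - p) * y

theorem lintegral_scoreMeasure (p : unitInterval) (h : Bool → ENNReal) :
    ∫⁻ s, h s ∂(scoreMeasure p) = mix p (h true) (h false) := by
  unfold scoreMeasure mix
  rw [ProbabilityTheory.bernoulliMeasure_def, lintegral_add_measure]
  have h1 : ((unitInterval.toNNReal p : NNReal) : ENNReal) = ENNReal.ofReal (p : ℝ) := by
    rw [← unitInterval.coe_toNNReal, ENNReal.ofReal_coe_nnreal]
  have h2 : ((unitInterval.toNNReal (unitInterval.symm p) : NNReal) : ENNReal)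
      = ENNReal.ofReal (1 - p : ℝ) := by
    rw [← unitInterval.coe_symm_eq, ← unitInterval.coe_toNNReal, ENNReal.ofReal_coe_nnreal]
  rw [← h1, ← h2]
  rw [lintegral_smul_measure, lintegral_smul_measure, lintegral_dirac, lintegral_dirac]
  rfl

theorem scoreMeasure_true (p : unitInterval) :
    scoreMeasure p {true} = ENNReal.ofReal p := by
  rw [← lintegral_indicator_one (measurableSet_singleton _), lintegral_scoreMeasure]
  simp [mix]

theorem mix_mix {p a b : ℝ} (hp : p ∈ unitInterval) (ha : a ∈ unitInterval)
    (hb : b ∈ unitInterval) (x y : ENNReal) :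
    mix p (mix a x y) (mix b x y) = mix (p * a + (1 - p) * b) x y := by
  obtain ⟨hp0, hp1⟩ := hp
  obtain ⟨ha0, ha1⟩ := ha
  obtain ⟨hb0, hb1⟩ := hb
  have hp1 := sub_nonneg.2 hp1
  have ha1 := sub_nonneg.2 ha1
  have hb1 := sub_nonneg.2 hb1
  have e : 1 - (p * a + (1 - p) * b) = p * (1 - a) + (1 - p) * (1 - b) := by ring
  unfold mix
  rw [e, ENNReal.ofReal_add (by positivity) (by positivity),
    ENNReal.ofReal_add (by positivity) (by positivity), ENNReal.ofReal_mul hp0,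
    ENNReal.ofReal_mul hp1, ENNReal.ofReal_mul hp0, ENNReal.ofReal_mul hp1]
  ring

theorem mix_zero (x y : ENNReal) : mix 0 x y = y := by simp [mix]

theorem mix_mix_right {p a : ℝ} (hp : p ∈ unitInterval) (ha : a ∈ unitInterval) (x y : ENNReal) :
    mix p (mix a x y) y = mix (p * a) x y := by
  have h := mix_mix hp ha ⟨le_rfl, zero_le_one⟩ x y
  rwa [mix_zero, mul_zero, add_zero] at h

instance (p : unitInterval) : IsProbabilityMeasure (scoreMeasure p) := by
  unfold scoreMeasure; infer_instance

theorem stochDominates_iff (μ ν : Measure Bool) [IsProbabilityMeasure μ] [IsProbabilityMeasure ν] :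
    StochDominates μ ν ↔ ν {true} ≤ μ {true} := by
  have hc : (Set.Iic false) = ({true} : Set Bool)ᶜ := by ext b; cases b <;> simp
  have hu : (Set.Iic true) = (Set.univ : Set Bool) := by ext b; cases b <;> simp
  have h : ∀ ρ : Measure Bool, IsProbabilityMeasure ρ → ρ (Set.Iic false) = 1 - ρ {true} :=
    fun ρ _ => by rw [hc, prob_compl_eq_one_sub (measurableSet_singleton _)]
  unfold StochDominates
  simp only [Bool.forall_bool, hu, measure_univ, le_refl, and_true, h μ inferInstance,
    h ν inferInstance]
  exact ⟨fun hle => (ENNReal.sub_le_sub_iff_left prob_le_one ENNReal.one_ne_top).1 hle,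
    fun hle => tsub_le_tsub_left hle 1⟩

theorem eq_iff_apply_true_eq (μ ν : Measure Bool) [IsProbabilityMeasure μ]
    [IsProbabilityMeasure ν] : μ = ν ↔ μ {true} = ν {true} := by
  refine ⟨fun h => h ▸ rfl, fun h => Measure.ext_of_singleton fun b => ?_⟩
  cases b
  · have hc : ({false} : Set Bool) = {true}ᶜ := by ext b; cases b <;> simp
    rw [hc, prob_compl_eq_one_sub (measurableSet_singleton _),
      prob_compl_eq_one_sub (measurableSet_singleton _), h]
  · exact h

theorem mix_mem {p a b : ℝ} (hp : p ∈ unitInterval) (ha : a ∈ unitInterval)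
    (hb : b ∈ unitInterval) : p * a + (1 - p) * b ∈ unitInterval := by
  have h := (convex_Icc (0 : ℝ) 1) ha hb hp.1 (sub_nonneg.2 hp.2) (by ring)
  simpa using h

theorem mix_ofReal {p a b : ℝ} (hp : p ∈ unitInterval) (ha : a ∈ unitInterval)
    (hb : b ∈ unitInterval) :
    mix p (ENNReal.ofReal a) (ENNReal.ofReal b) = ENNReal.ofReal (p * a + (1 - p) * b) := by
  have h := mix_mix hp ha hb 1 0
  simpa [mix] using h

/-- The transition to scores with passing probability `q`. -/
noncomputable def scoreOf {Y : Type*} [MeasurableSpace Y] (q : Y → unitInterval)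
    (hq : UnivMeasurable q) : MarkovTransition Y Bool where
  toFun y := scoreMeasure (q y)
  isProb _ := inferInstance
  univMeasurable B _ := (measurable_scoreMeasure B).comp hq

theorem scoreOf_apply {Y : Type*} [MeasurableSpace Y] (q : Y → unitInterval)
    (hq : UnivMeasurable q) (y : Y) : scoreOf q hq y = scoreMeasure (q y) := rfl

/-- A monotone score conversion, written through its passing probabilities `a` (from a pass) and
`b` (from a fail). -/
theorem moreDiscerning_iff {T Θ : Type*} [MeasurableSpace T] [MeasurableSpace Θ]
    (P : PassageRate T Θ) (θ : Θ) (τ ψ : T) :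
    MoreDiscerning P θ τ ψ ↔ ∃ a b : unitInterval, b ≤ a ∧
      (P.rate (τ, θ) * a + (1 - P.rate (τ, θ)) * b : ℝ) = P.rate (ψ, θ) ∧
      ∀ θ' ≠ θ, (P.rate (τ, θ') * a + (1 - P.rate (τ, θ')) * b : ℝ) ≤ P.rate (ψ, θ') := by
  have key : ∀ (k : Bool → Measure Bool) (p : unitInterval), ((scoreMeasure p).bind k) {true}
      = mix p (k true {true}) (k false {true}) := fun k p => by
    rw [Measure.bind_apply (measurableSet_singleton _) (by fun_prop), lintegral_scoreMeasure]
  have hp : ∀ (k : MarkovTransition Bool Bool) (p : unitInterval),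
      IsProbabilityMeasure ((scoreMeasure p).bind k) := fun k p =>
    isProbabilityMeasure_bind (Measurable.of_discrete.aemeasurable) (.of_forall k.isProb)
  unfold MoreDiscerning IsMonotone
  simp only [stochDominates_iff, eq_iff_apply_true_eq, key, scoreMeasure_true]
  constructor
  · rintro ⟨k, hk, h1, h2⟩
    have hI : ∀ s, (k s {true}).toReal ∈ unitInterval := fun s =>
      ⟨ENNReal.toReal_nonneg, ENNReal.toReal_mono ENNReal.one_ne_top prob_le_one⟩
    have hof : ∀ s, k s {true} = ENNReal.ofReal (k s {true}).toReal := fun s =>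
      (ENNReal.ofReal_toReal (measure_ne_top _ _)).symm
    refine ⟨⟨_, hI true⟩, ⟨_, hI false⟩, ENNReal.toReal_mono (measure_ne_top _ _) hk, ?_, ?_⟩
    · rw [hof true, hof false, mix_ofReal (P.rate _).2 (hI _) (hI _)] at h1
      have h0 := mix_mem (P.rate (τ, θ)).2 (hI true) (hI false)
      exact (ENNReal.ofReal_eq_ofReal_iff h0.1 (P.rate _).2.1).1 h1
    · intro θ' hθ'
      have h := h2 θ' hθ'
      rw [hof true, hof false, mix_ofReal (P.rate _).2 (hI _) (hI _)] at h
      exact (ENNReal.ofReal_le_ofReal_iff (P.rate _).2.1).1 h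
  · rintro ⟨a, b, hba, h1, h2⟩
    refine ⟨scoreOf (fun s : Bool => bif s then a else b)
      (univMeasurable_of_measurable .of_discrete), ?_, ?_, fun θ' hθ' => ?_⟩
    all_goals simp only [scoreOf_apply, cond_true, cond_false, scoreMeasure_true]
    · exact ENNReal.ofReal_le_ofReal hba
    · rw [mix_ofReal (P.rate _).2 a.2 b.2, h1]
    · rw [mix_ofReal (P.rate _).2 a.2 b.2]
      exact ENNReal.ofReal_le_ofReal (h2 θ' hθ')

/-! ### A universally measurable choice of score conversions -/

section Choice

open Set

section Conversion

variable {T Θ : Type*} [MeasurableSpace T] [MeasurableSpace Θ]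

open Classical in
/-- The lower bound that type `z.2` puts on the slope of a conversion of scores on `t z.1.1` into
scores on `z.1.2`: a type that is less likely to pass `t z.1.1` than `z.1.1` itself must lose at
least the difference in passage rates on `z.1.2`. Types that are at least as likely to pass only
bound the slope from above, and contribute `0`. -/
noncomputable def slopeBound (P : PassageRate T Θ) (t : Θ → T) (z : (Θ × T) × Θ) : ℝ :=
  if (P.rate (t z.1.1, z.2) : ℝ) < P.rate (t z.1.1, z.1.1) then
    (P.rate (z.1.2, z.1.1) - P.rate (z.1.2, z.2)) /
      (P.rate (t z.1.1, z.1.1) - P.rate (t z.1.1, z.2))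
  else 0

theorem measurable_slopeBound (P : PassageRate T Θ) {t : Θ → T} (ht : Measurable t) :
    Measurable (slopeBound P t) := by
  have h : Measurable fun w : T × Θ => (P.rate w : ℝ) := measurable_subtype_coe.comp P.measurable
  have h1 : Measurable fun z : (Θ × T) × Θ => (P.rate (t z.1.1, z.2) : ℝ) :=
    h.comp (by fun_prop : Measurable fun z : (Θ × T) × Θ => (t z.1.1, z.2))
  have h2 : Measurable fun z : (Θ × T) × Θ => (P.rate (t z.1.1, z.1.1) : ℝ) :=
    h.comp (by fun_prop : Measurable fun z : (Θ × T) × Θ => (t z.1.1, z.1.1))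
  have h3 : Measurable fun z : (Θ × T) × Θ => (P.rate (z.1.2, z.1.1) : ℝ) :=
    h.comp (by fun_prop : Measurable fun z : (Θ × T) × Θ => (z.1.2, z.1.1))
  have h4 : Measurable fun z : (Θ × T) × Θ => (P.rate (z.1.2, z.2) : ℝ) :=
    h.comp (by fun_prop : Measurable fun z : (Θ × T) × Θ => (z.1.2, z.2))
  exact Measurable.ite (measurableSet_lt h1 h2) ((h3.sub h4).div (h2.sub h1)) measurable_const

/-- The score conversions that witness that `t` is most discerning can be chosen universally
measurably: the flattest admissible conversion has an explicit formula in terms of the supremum of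
the slope bounds. -/
theorem MostDiscerning.exists_univMeasurable_conversion
    [TopologicalSpace Θ] [PolishSpace Θ] [BorelSpace Θ]
    [TopologicalSpace T] [PolishSpace T] [BorelSpace T]
    {P : PassageRate T Θ} {t : Θ → T} (ht : Measurable t) (h : MostDiscerning P t) :
    ∃ a b : Θ × T → unitInterval, UnivMeasurable a ∧ UnivMeasurable b ∧ ∀ θ ψ,
      b (θ, ψ) ≤ a (θ, ψ) ∧
      (P.rate (t θ, θ) * a (θ, ψ) + (1 - P.rate (t θ, θ)) * b (θ, ψ) : ℝ) = P.rate (ψ, θ) ∧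
      ∀ θ', (P.rate (t θ, θ') * a (θ, ψ) + (1 - P.rate (t θ, θ')) * b (θ, ψ) : ℝ)
        ≤ P.rate (ψ, θ') := by
  rcases isEmpty_or_nonempty Θ with hΘ | hΘ
  · exact ⟨fun _ => 0, fun _ => 0, univMeasurable_of_measurable measurable_const,
      univMeasurable_of_measurable measurable_const, fun θ => hΘ.elim θ⟩
  let d : Θ × T → ℝ := fun x => ⨆ θ', slopeBound P t (x, θ')
  have hle : ∀ x : Θ × T, ∃ α β : ℝ, 0 ≤ β ∧ α ≤ 1 ∧
      (P.rate (t x.1, x.1) * α + (1 - P.rate (t x.1, x.1)) * β : ℝ) = P.rate (x.2, x.1) ∧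
      (∀ θ', (P.rate (t x.1, θ') * α + (1 - P.rate (t x.1, θ')) * β : ℝ)
        ≤ P.rate (x.2, θ')) ∧ ∀ θ', slopeBound P t (x, θ') ≤ α - β := by
    intro x
    obtain ⟨α, β, hβα, h1, h2⟩ := (moreDiscerning_iff P x.1 (t x.1) x.2).1 (h x.1 x.2)
    have h3 : ∀ θ', (P.rate (t x.1, θ') * α + (1 - P.rate (t x.1, θ')) * β : ℝ)
        ≤ P.rate (x.2, θ') := fun θ' => by
      rcases eq_or_ne θ' x.1 with rfl | hne
      · exact h1.le
      · exact h2 θ' hne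
    refine ⟨α, β, β.2.1, α.2.2, h1, h3, fun θ' => ?_⟩
    unfold slopeBound
    split_ifs with hlt
    · rw [div_le_iff₀ (sub_pos.2 hlt)]
      linarith [h3 θ']
    · exact sub_nonneg.2 hβα
  have hbdd : ∀ x, BddAbove (range fun θ' => slopeBound P t (x, θ')) := fun x => by
    obtain ⟨α, β, -, -, -, -, hs⟩ := hle x
    exact ⟨α - β, forall_mem_range.2 hs⟩
  have hd : UnivMeasurable d := univMeasurable_iSup_of_polish (measurable_slopeBound P ht) hbdd
  have hd0 : ∀ x, 0 ≤ d x := fun x =>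
    le_ciSup_of_le (hbdd x) x.1 (by simp [slopeBound])
  have hP : ∀ θ τ, 0 ≤ (P.rate (τ, θ) : ℝ) ∧ 0 ≤ 1 - (P.rate (τ, θ) : ℝ) := fun θ τ =>
    ⟨(P.rate _).2.1, sub_nonneg.2 (P.rate _).2.2⟩
  have ha : ∀ x : Θ × T, (P.rate (x.2, x.1) + (1 - P.rate (t x.1, x.1)) * d x : ℝ)
      ∈ unitInterval := fun x => by
    obtain ⟨α, β, hβ, hα, h1, -, hs⟩ := hle x
    have hdx : d x ≤ α - β := ciSup_le hs
    refine ⟨add_nonneg (hP _ _).1 (mul_nonneg (hP _ _).2 (hd0 x)), ?_⟩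
    linarith [mul_le_mul_of_nonneg_left hdx (hP x.1 (t x.1)).2]
  have hb : ∀ x : Θ × T, (P.rate (x.2, x.1) - P.rate (t x.1, x.1) * d x : ℝ)
      ∈ unitInterval := fun x => by
    obtain ⟨α, β, hβ, hα, h1, -, hs⟩ := hle x
    have hdx : d x ≤ α - β := ciSup_le hs
    refine ⟨?_, ?_⟩
    · linarith [mul_le_mul_of_nonneg_left hdx (hP x.1 (t x.1)).1]
    · linarith [mul_nonneg (hP x.1 (t x.1)).1 (hd0 x), (P.rate (x.2, x.1)).2.2]
  have hm : Measurable fun w : T × Θ => (P.rate w : ℝ) := measurable_subtype_coe.comp P.measurable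
  have hp : UnivMeasurable fun x : Θ × T => (P.rate (t x.1, x.1) : ℝ) :=
    univMeasurable_of_measurable
      (hm.comp (by fun_prop : Measurable fun x : Θ × T => (t x.1, x.1)))
  have hq : UnivMeasurable fun x : Θ × T => (P.rate (x.2, x.1) : ℝ) :=
    univMeasurable_of_measurable (hm.comp measurable_swap)
  refine ⟨fun x => ⟨_, ha x⟩, fun x => ⟨_, hb x⟩, ?_, ?_, fun θ ψ => ⟨?_, ?_, fun θ' => ?_⟩⟩
  · exact Measurable.subtype_mk
      (hq.add ((measurable_const.sub hp).mul hd))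
  · exact Measurable.subtype_mk (hq.sub (hp.mul hd))
  · have := hd0 (θ, ψ)
    rw [← Subtype.coe_le_coe]
    simp only
    linarith
  · simp only
    ring
  · obtain ⟨α, β, -, -, h1, h2, hs⟩ := hle (θ, ψ)
    have hdx : d (θ, ψ) ≤ α - β := ciSup_le hs
    have h2 := h2 θ'
    simp only at h1 h2 ⊢
    have key : ((P.rate (t θ, θ') - P.rate (t θ, θ)) * d (θ, ψ) : ℝ)
        ≤ P.rate (ψ, θ') - P.rate (ψ, θ) := by
      rcases lt_or_ge (P.rate (t θ, θ') : ℝ) (P.rate (t θ, θ)) with hlt | hge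
      · have hsl := le_ciSup (hbdd (θ, ψ)) θ'
        simp only [slopeBound, if_pos hlt] at hsl
        rw [div_le_iff₀ (sub_pos.2 hlt)] at hsl
        have : (⨆ i, slopeBound P t ((θ, ψ), i)) = d (θ, ψ) := rfl
        simp only [slopeBound] at this
        rw [this] at hsl
        linarith
      · have := mul_le_mul_of_nonneg_left hdx (sub_nonneg.2 hge)
        linarith
    linarith

end Conversion

end Choice

/-! ### Agents who only care about passing -/

section Converse

variable {T Θ : Type*} [MeasurableSpace T] [MeasurableSpace Θ]

/-- A strategy with a deterministic constant report and constant effort. -/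
noncomputable def constStrategy {M : Type*} [MeasurableSpace M] (m : M) (e : unitInterval) :
    Strategy Θ M T where
  report := .deterministic (fun _ => m) measurable_const
  effort _ := e
  effort_univMeasurable := univMeasurable_of_measurable measurable_const

variable [MeasurableSpace.CountablyGenerated T] [MeasurableSingletonClass T]

/-- If the report of `θ` and the test after it are deterministic, the decision is a mixture over
the two scores. -/
theorem inducedSCF_apply_of_dirac {X M : Type*} [MeasurableSpace X]
    [MeasurableSpace.CountablyGenerated X] [MeasurableSpace M]
    [MeasurableSpace.CountablyGenerated M] [MeasurableSingletonClass M] (P : PassageRate T Θ)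
    (μ : Mechanism M T X) (σ : Strategy Θ M T) {θ : Θ} {m : M} {τ : T}
    (hr : σ.report θ = Measure.dirac m) (ht : μ.testingRule m = Measure.dirac τ)
    {B : Set X} (hB : MeasurableSet B) :
    inducedSCF P μ σ θ B = mix (σ.effort (θ, m, τ) * P.rate (τ, θ))
      (μ.decisionRule (m, τ, true) B) (μ.decisionRule (m, τ, false) B) := by
  rw [inducedSCF_apply P μ σ θ hB, hr, lintegral_dirac, ht, lintegral_dirac,
    lintegral_scoreMeasure]
  rfl

/-- The utility function of agents who only care about passing: the decision is the verdict. -/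
def passUtility (Θ : Type u) [MeasurableSpace Θ] : Utility (ULift.{u} Bool) Θ where
  val x := bif x.1.down then 1 else 0
  measurable := (Measurable.of_discrete (f := fun b : Bool => bif b then (1 : ℝ) else 0)).comp
    (measurable_down.comp measurable_fst)

theorem passUtility_loss {Θ : Type u} [MeasurableSpace Θ] (θ : Θ) (ν : Measure (ULift.{u} Bool)) :
    (passUtility Θ).loss θ ν = 0 := by
  have : ∀ x : ULift.{u} Bool, ENNReal.ofReal (-(passUtility Θ).val (x, θ)) = 0 := by
    rintro ⟨_ | _⟩ <;> simp [passUtility]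
  simp [Utility.loss, this]

theorem passUtility_gain {Θ : Type u} [MeasurableSpace Θ] (θ : Θ) (ν : Measure (ULift.{u} Bool)) :
    (passUtility Θ).gain θ ν = ν {⟨true⟩} := by
  rw [← lintegral_indicator_one (measurableSet_singleton _)]
  refine lintegral_congr ?_
  rintro ⟨_ | _⟩ <;> simp [passUtility]

theorem passUtility_expected_le_iff {Θ : Type u} [MeasurableSpace Θ] (θ : Θ)
    (ν ν' : Measure (ULift.{u} Bool)) :
    (passUtility Θ).expected θ ν ≤ (passUtility Θ).expected θ ν' ↔
      ν {⟨true⟩} ≤ ν' {⟨true⟩} := by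
  simp [Utility.expected, passUtility_loss, passUtility_gain]

/-- The mechanism that asks for no information, always gives the test `ψ`, and whose decision is
the score. -/
noncomputable def passMechanism (ψ : T) : Mechanism PUnit.{u + 1} T (ULift.{u} Bool) where
  testingRule := .deterministic (fun _ => ψ) measurable_const
  decisionRule := .deterministic (fun h => ⟨h.2.2⟩)
    (measurable_up.comp (measurable_snd.comp measurable_snd))

theorem passMechanism_apply {Θ : Type u} [MeasurableSpace Θ] (P : PassageRate T Θ) (ψ : T)
    (σ : Strategy Θ PUnit.{u + 1} T) (θ : Θ) :
    inducedSCF P (passMechanism ψ) σ θ {⟨true⟩} =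
      ENNReal.ofReal (σ.effort (θ, ⟨⟩, ψ) * P.rate (ψ, θ)) := by
  have hr : σ.report θ = Measure.dirac PUnit.unit := by
    refine Measure.ext_of_singleton fun a => ?_
    have : ({a} : Set PUnit) = Set.univ := Set.eq_univ_of_univ_subset fun _ _ => rfl
    rw [this, measure_univ, measure_univ]
  rw [inducedSCF_apply_of_dirac P _ σ hr (m := ⟨⟩) (τ := ψ) rfl (measurableSet_singleton _)]
  simp [passMechanism, MarkovTransition.deterministic, mix]

/-- If the social choice function "pass with the probability of passing `ψ`" is canonically
implementable with `t` for agents who want to pass, the canonical decision rule at the report `θ`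
converts scores on `t θ` into scores on `ψ`. -/
theorem moreDiscerning_of_canonicallyImplementable {Θ : Type u} [MeasurableSpace Θ]
    [MeasurableSpace.CountablyGenerated Θ] [MeasurableSingletonClass Θ] (P : PassageRate T Θ)
    {t : Θ → T} (ht : Measurable t) (θ : Θ) (ψ : T) (f : MarkovTransition Θ (ULift.{u} Bool))
    (hf : ∀ θ', f θ' {⟨true⟩} = ENNReal.ofReal (P.rate (ψ, θ')))
    (h : CanonicallyImplementableWith P (passUtility Θ) (.deterministic t ht) f) :
    MoreDiscerning P θ (t θ) ψ := by
  obtain ⟨g, σ, ⟨hr, he⟩, hIC, rfl⟩ := h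
  obtain ⟨A, hA, hgA⟩ : ∃ A : Bool → ℝ, (∀ s, A s ∈ unitInterval) ∧
      ∀ s, g (θ, t θ, s) {⟨true⟩} = ENNReal.ofReal (A s) :=
    ⟨fun s => (g (θ, t θ, s) {⟨true⟩}).toReal, fun s => ⟨ENNReal.toReal_nonneg,
      ENNReal.toReal_mono ENNReal.one_ne_top prob_le_one⟩,
      fun s => (ENNReal.ofReal_toReal (measure_ne_top _ _)).symm⟩
  have happly : ∀ (σ' : Strategy Θ Θ T) (θ' : Θ), σ'.report θ' = Measure.dirac θ →
      inducedSCF P ⟨.deterministic t ht, g⟩ σ' θ' {⟨true⟩} =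
        ENNReal.ofReal ((σ'.effort (θ', θ, t θ) * P.rate (t θ, θ') : unitInterval) * A true +
          (1 - (σ'.effort (θ', θ, t θ) * P.rate (t θ, θ') : unitInterval)) * A false) := by
    intro σ' θ' hr'
    rw [inducedSCF_apply_of_dirac P _ σ' hr' (τ := t θ) rfl (measurableSet_singleton _),
      ← mix_ofReal (Subtype.prop _) (hA _) (hA _), ← hgA, ← hgA]
    rfl
  have hdev : ∀ (e : unitInterval) (θ' : Θ),
      ((e * P.rate (t θ, θ') : unitInterval) * A true +
        (1 - (e * P.rate (t θ, θ') : unitInterval)) * A false : ℝ) ≤ P.rate (ψ, θ') := by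
    intro e θ'
    have h1 := (hIC (constStrategy θ e) θ').2
    rw [passUtility_expected_le_iff, hf, happly _ _ rfl] at h1
    exact (ENNReal.ofReal_le_ofReal_iff (P.rate _).2.1).1 h1
  have heq : (P.rate (t θ, θ) * A true + (1 - P.rate (t θ, θ)) * A false : ℝ)
      = P.rate (ψ, θ) := by
    have h1 := hf θ
    rw [happly σ θ (by rw [hr]; rfl), he θ (t θ), one_mul,
      ENNReal.ofReal_eq_ofReal_iff (mix_mem (Subtype.prop _) (hA _) (hA _)).1 (P.rate _).2.1] at h1
    exact h1
  rw [moreDiscerning_iff]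
  have hfail : ∀ θ', A false ≤ P.rate (ψ, θ') := fun θ' => by simpa using hdev 0 θ'
  rcases le_or_gt (A false) (A true) with hle | hlt
  · exact ⟨⟨_, hA true⟩, ⟨_, hA false⟩, hle, heq, fun θ' _ => by simpa using hdev 1 θ'⟩
  · -- A pass is worse than a fail only if `θ` never passes `t θ`; then fails alone matter.
    have hp : (P.rate (t θ, θ) : ℝ) = 0 := by
      refine le_antisymm ?_ (P.rate _).2.1
      by_contra! hpos
      nlinarith [hfail θ, heq]
    rw [hp] at heq
    refine ⟨⟨_, hA false⟩, ⟨_, hA false⟩, le_rfl, ?_, fun θ' _ => ?_⟩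
    · simp only
      linarith
    · simp only
      linarith [hfail θ']

theorem mostDiscerning_of_forall_canonicallyImplementable {Θ : Type u} [MeasurableSpace Θ]
    [MeasurableSpace.CountablyGenerated Θ] [MeasurableSingletonClass Θ]
    (P : PassageRate T Θ) {t : Θ → T} (ht : Measurable t)
    (h : ∀ f : MarkovTransition Θ (ULift.{u} Bool), Implementable P (passUtility Θ) f →
      CanonicallyImplementableWith P (passUtility Θ) (.deterministic t ht) f) :
    MostDiscerning P t := by
  intro θ ψ
  have hf : ∀ θ', inducedSCF P (passMechanism.{u} ψ) (constStrategy PUnit.unit 1) θ' {⟨true⟩} =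
      ENNReal.ofReal (P.rate (ψ, θ')) := fun θ' => by
    rw [passMechanism_apply]
    simp [constStrategy]
  refine moreDiscerning_of_canonicallyImplementable P ht θ ψ _ hf (h _ ?_)
  refine ⟨PUnit, inferInstance, inferInstance, inferInstance, inferInstance, passMechanism ψ,
    constStrategy ⟨⟩ 1, fun σ' θ' => ⟨.inr (by simp [passUtility_loss]), ?_⟩, rfl⟩
  rw [passUtility_expected_le_iff, hf, passMechanism_apply]
  exact ENNReal.ofReal_le_ofReal (mul_le_of_le_one_left (P.rate _).2.1 (σ'.effort _).2.2)

end Converse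

/-! ### Universally measurable transitions and conditional means -/

section Measurability

variable {Y : Type*} [MeasurableSpace Y]

theorem univMeasurable_mix {q : Y → ℝ} {g h : Y → ENNReal} (hq : UnivMeasurable q)
    (hg : UnivMeasurable g) (hh : UnivMeasurable h) :
    UnivMeasurable fun y => mix (q y) (g y) (h y) :=
  ((ENNReal.measurable_ofReal.comp hq).mul hg).add
    ((ENNReal.measurable_ofReal.comp (measurable_const.sub hq)).mul hh)

theorem UnivMeasurable.coe_unitInterval {q : Y → unitInterval} (hq : UnivMeasurable q) :
    UnivMeasurable fun y => (q y : ℝ) :=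
  measurable_subtype_coe.comp hq

theorem UnivMeasurable.mul_unitInterval {q r : Y → unitInterval} (hq : UnivMeasurable q)
    (hr : UnivMeasurable r) : UnivMeasurable fun y => q y * r y :=
  @Measurable.mul unitInterval _ _ _ (universalCompletion Y) _ _ _ hq hr

theorem mix_lintegral (p : ℝ) (μ : Measure Y) {g h : Y → ENNReal} (hg : AEMeasurable g μ) :
    mix p (∫⁻ y, g y ∂μ) (∫⁻ y, h y ∂μ) = ∫⁻ y, mix p (g y) (h y) ∂μ := by
  unfold mix
  rw [lintegral_add_left' (hg.const_mul _), lintegral_const_mul' _ _ ENNReal.ofReal_ne_top,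
    lintegral_const_mul' _ _ ENNReal.ofReal_ne_top]

end Measurability

section Transitions

variable {X Y Z : Type*} [MeasurableSpace X] [MeasurableSpace Y] [MeasurableSpace Z]
  [MeasurableSpace.CountablyGenerated Y] [MeasurableSpace.CountablyGenerated Z]

theorem MarkovTransition.lintegral_andThen (k : MarkovTransition X Y)
    (l : MarkovTransition (X × Y) Z) {h : Z → ENNReal} (hh : UnivMeasurable h) (x : X) :
    ∫⁻ z, h z ∂(k.andThen l x) = ∫⁻ y, ∫⁻ z, h z ∂(l (x, y)) ∂(k x) :=
  Measure.lintegral_bind ((l.comap (Prod.mk x) measurable_prodMk_left).aemeasurable (k x))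
    (hh.aemeasurable (k.andThen l x))

/-- The joint distribution of `y`, drawn from `k x`, and `z`, drawn from `l (x, y)`. -/
noncomputable def MarkovTransition.joint (k : MarkovTransition X Y)
    (l : MarkovTransition (X × Y) Z) : MarkovTransition X (Y × Z) :=
  k.andThen (l.andThen (.deterministic (fun w => (w.1.2, w.2)) (by fun_prop)))

theorem MarkovTransition.lintegral_joint [MeasurableSingletonClass Y] [MeasurableSingletonClass Z]
    (k : MarkovTransition X Y) (l : MarkovTransition (X × Y) Z) {h : Y × Z → ENNReal}
    (hh : UnivMeasurable h) (x : X) :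
    ∫⁻ w, h w ∂(k.joint l x) = ∫⁻ y, ∫⁻ z, h (y, z) ∂(l (x, y)) ∂(k x) := by
  unfold joint
  rw [lintegral_andThen _ _ hh]
  refine lintegral_congr fun y => ?_
  rw [lintegral_andThen _ _ hh]
  refine lintegral_congr fun z => ?_
  exact lintegral_dirac _ _

end Transitions

/-- A mixing probability that depends on a latent variable `z.1` can be replaced by its conditional
mean given the observed variable `z.2`, without changing the distribution of outcomes that depend on
`z` through `z.2` alone. -/
theorem exists_measurable_conditional_mean {Z W : Type*} [MeasurableSpace Z] [MeasurableSpace W]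
    (L : Measure (Z × W)) [IsProbabilityMeasure L] {q : Z × W → ℝ} (hq : AEMeasurable q L)
    (hqI : ∀ z, q z ∈ unitInterval) :
    ∃ a : W → unitInterval, Measurable a ∧ ∀ h₁ h₀ : W → ENNReal,
      AEMeasurable h₁ (L.map Prod.snd) → AEMeasurable h₀ (L.map Prod.snd) → (∀ w, h₀ w ≤ 1) →
      ∫⁻ w, mix (a w) (h₁ w) (h₀ w) ∂(L.map Prod.snd) =
        ∫⁻ z, mix (q z) (h₁ z.2) (h₀ z.2) ∂L := by
  -- The conditional mean is the density of the `q`-weighted marginal in the marginal.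
  set ρ := L.map Prod.snd with hρ
  have : IsProbabilityMeasure ρ := Measure.isProbabilityMeasure_map measurable_snd.aemeasurable
  have hq' : AEMeasurable (fun z => ENNReal.ofReal (q z)) L := hq.ennreal_ofReal
  have hLL : L.withDensity (fun z => ENNReal.ofReal (q z)) ≤ L := by
    conv_rhs => rw [← withDensity_one (μ := L)]
    exact withDensity_mono (.of_forall fun z => ENNReal.ofReal_le_one.2 (hqI z).2)
  set ν := (L.withDensity fun z => ENNReal.ofReal (q z)).map Prod.snd with hν
  have hνρ : ν ≤ ρ := Measure.map_mono hLL measurable_snd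
  have : IsFiniteMeasure ν := isFiniteMeasure_of_le ρ hνρ
  let a : W → unitInterval := fun w => Set.projIcc 0 1 zero_le_one (ν.rnDeriv ρ w).toReal
  have ha : Measurable a :=
    continuous_projIcc.measurable.comp (Measure.measurable_rnDeriv ν ρ).ennreal_toReal
  have haν : ∀ᵐ w ∂ρ, ENNReal.ofReal (a w) = ν.rnDeriv ρ w := by
    filter_upwards [Measure.rnDeriv_le_one_of_le hνρ] with w hw
    have h1 : (ν.rnDeriv ρ w).toReal ∈ unitInterval :=
      ⟨ENNReal.toReal_nonneg, ENNReal.toReal_mono ENNReal.one_ne_top hw⟩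
    simp only [a, Set.projIcc_of_mem _ h1]
    exact ENNReal.ofReal_toReal (ne_top_of_le_ne_top ENNReal.one_ne_top hw)
  have hmean : ∀ h : W → ENNReal, AEMeasurable h ρ →
      ∫⁻ w, ENNReal.ofReal (a w) * h w ∂ρ = ∫⁻ z, ENNReal.ofReal (q z) * h z.2 ∂L := by
    intro h hh
    have h2 : AEMeasurable (fun z : Z × W => h z.2) L := hh.comp_measurable measurable_snd
    rw [lintegral_congr_ae (haν.mono fun w hw => by rw [hw]),
      lintegral_rnDeriv_mul hνρ.absolutelyContinuous hh, hν,
      lintegral_map' (hh.mono_measure hνρ) measurable_snd.aemeasurable,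
      lintegral_withDensity_eq_lintegral_mul₀ hq' h2]
    rfl
  refine ⟨a, ha, fun h₁ h₀ hh₁ hh₀ hle => ?_⟩
  have ha' : Measurable fun w => ENNReal.ofReal (a w) :=
    (measurable_subtype_coe.comp ha).ennreal_ofReal
  have hah₁ : AEMeasurable (fun w => ENNReal.ofReal (a w) * h₁ w) ρ := ha'.aemeasurable.mul hh₁
  have hah₀ : AEMeasurable (fun w => ENNReal.ofReal (a w) * h₀ w) ρ := ha'.aemeasurable.mul hh₀
  have hqh₁ : AEMeasurable (fun z => ENNReal.ofReal (q z) * h₁ z.2) L :=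
    hq'.mul (hh₁.comp_measurable measurable_snd)
  have hqh₀ : AEMeasurable (fun z => ENNReal.ofReal (q z) * h₀ z.2) L :=
    hq'.mul (hh₀.comp_measurable measurable_snd)
  have hsplit : ∀ (p : ℝ), p ∈ unitInterval → ∀ y : ENNReal,
      ENNReal.ofReal p * y + ENNReal.ofReal (1 - p) * y = y := fun p hp y => by
    rw [← add_mul, ← ENNReal.ofReal_add hp.1 (sub_nonneg.2 hp.2)]
    simp
  have hcomp : ∫⁻ w, ENNReal.ofReal (1 - a w) * h₀ w ∂ρ =
      ∫⁻ z, ENNReal.ofReal (1 - q z) * h₀ z.2 ∂L := by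
    have hfin : ∫⁻ w, ENNReal.ofReal (a w) * h₀ w ∂ρ ≠ ⊤ := by
      refine ne_top_of_le_ne_top ENNReal.one_ne_top ?_
      calc _ ≤ ∫⁻ _, 1 ∂ρ := lintegral_mono fun w =>
            mul_le_one' (ENNReal.ofReal_le_one.2 (a w).2.2) (hle w)
        _ = 1 := by simp
    refine (ENNReal.add_right_inj hfin).1 ?_
    rw [← lintegral_add_left' hah₀]
    simp only [hsplit _ (a _).2]
    rw [hmean _ hh₀, ← lintegral_add_left' hqh₀]
    simp only [hsplit _ (hqI _)]
    rw [hρ, lintegral_map' hh₀ measurable_snd.aemeasurable]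
  unfold mix
  rw [lintegral_add_left' hah₁, lintegral_add_left' hqh₁,
    hmean _ hh₁, hcomp]

/-! ### Simulating a profile with other tests -/

theorem univMeasurable_decisionRule {T M X : Type*} [MeasurableSpace T] [MeasurableSpace M]
    [MeasurableSpace X] (μ : Mechanism M T X) {B : Set X} (hB : MeasurableSet B) (s : Bool) :
    UnivMeasurable fun w : M × T => μ.decisionRule (w.1, w.2, s) B :=
  (μ.decisionRule.univMeasurable B hB).comp_measurable (φ := fun w : M × T => (w.1, w.2, s))
    (by fun_prop)

section Simulation

variable {Θ T M X : Type*} [MeasurableSpace Θ] [MeasurableSpace T] [MeasurableSpace M]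
  [MeasurableSpace X] [MeasurableSpace.CountablyGenerated T] [MeasurableSpace.CountablyGenerated M]
  [MeasurableSpace.CountablyGenerated X]

/-- The joint distribution of message and test for each type. -/
noncomputable def messageTest (μ : Mechanism M T X) (r : MarkovTransition Θ M) :
    MarkovTransition Θ (M × T) :=
  r.joint (μ.testingRule.comap Prod.snd measurable_snd)

/-- The decision rule that simulates the profile `(μ, σ)`. After the report `θ` and the score `s`,
it draws a message and a test `ψ` as type `θ` would under the profile, converts `s` into a score on
`ψ` with the passing probability `c ((θ, ψ), s)`, scales it by the effort of `θ`, and decides as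
`μ` does. -/
noncomputable def simulatedRule (μ : Mechanism M T X) (σ : Strategy Θ M T)
    {c : (Θ × T) × Bool → unitInterval} (hc : UnivMeasurable c) :
    MarkovTransition (Θ × T × Bool) X :=
  ((messageTest μ σ.report).comap Prod.fst measurable_fst).andThen <|
    (scoreOf (fun z : (Θ × T × Bool) × M × T =>
        σ.effort (z.1.1, z.2) * c ((z.1.1, z.2.2), z.1.2.2))
      ((σ.effort_univMeasurable.comp_measurable (by fun_prop)).mul_unitInterval
        (hc.comp_measurable (by fun_prop)))).andThen <|
      μ.decisionRule.comap (fun z => (z.1.2.1, z.1.2.2, z.2)) (by fun_prop)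

theorem simulatedRule_apply (μ : Mechanism M T X) (σ : Strategy Θ M T)
    {c : (Θ × T) × Bool → unitInterval} (hc : UnivMeasurable c) (h : Θ × T × Bool) {B : Set X}
    (hB : MeasurableSet B) :
    simulatedRule μ σ hc h B = ∫⁻ w, mix (σ.effort (h.1, w) * c ((h.1, w.2), h.2.2))
      (μ.decisionRule (w.1, w.2, true) B) (μ.decisionRule (w.1, w.2, false) B)
        ∂(messageTest μ σ.report h.1) := by
  unfold simulatedRule
  rw [MarkovTransition.andThen_apply _ _ _ hB]
  refine lintegral_congr fun w => ?_
  rw [MarkovTransition.andThen_apply _ _ _ hB, scoreOf_apply, lintegral_scoreMeasure]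
  rfl

variable [MeasurableSingletonClass T]

theorem inducedSCF_apply_eq_lintegral_messageTest [MeasurableSingletonClass M]
    (P : PassageRate T Θ) (μ : Mechanism M T X)
    (σ : Strategy Θ M T) (θ : Θ) {B : Set X} (hB : MeasurableSet B) :
    inducedSCF P μ σ θ B = ∫⁻ w, mix (σ.effort (θ, w) * P.rate (w.2, θ))
      (μ.decisionRule (w.1, w.2, true) B) (μ.decisionRule (w.1, w.2, false) B)
        ∂(messageTest μ σ.report θ) := by
  have hm : UnivMeasurable fun w : M × T => ((σ.effort (θ, w) * P.rate (w.2, θ) : ℝ)) :=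
    ((σ.effort_univMeasurable.comp_measurable measurable_prodMk_left).mul_unitInterval
      (univMeasurable_of_measurable (P.measurable.comp
        (by fun_prop : Measurable fun w : M × T => (w.2, θ))))).coe_unitInterval
  rw [inducedSCF_apply P μ σ θ hB, messageTest, MarkovTransition.lintegral_joint _ _
    (univMeasurable_mix hm (univMeasurable_decisionRule μ hB _)
      (univMeasurable_decisionRule μ hB _))]
  refine lintegral_congr fun m => lintegral_congr fun ψ => ?_
  rw [lintegral_scoreMeasure]
  rfl

/-- Under a simulated rule, the score on the simulated test is passed with the probability obtained
by converting the score distribution on the actual test. -/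
theorem inducedSCF_simulatedRule_apply [MeasurableSpace.CountablyGenerated Θ]
    (P : PassageRate T Θ) {t : Θ → T} (ht : Measurable t) (μ : Mechanism M T X)
    (σ : Strategy Θ M T) {c : (Θ × T) × Bool → unitInterval} (hc : UnivMeasurable c)
    (σ' : Strategy Θ Θ T) (θ : Θ) {B : Set X} (hB : MeasurableSet B) :
    inducedSCF P ⟨.deterministic t ht, simulatedRule μ σ hc⟩ σ' θ B =
      ∫⁻ θ', ∫⁻ w, mix (σ.effort (θ', w) *
          ((σ'.effort (θ, θ', t θ') * P.rate (t θ', θ) : unitInterval) * c ((θ', w.2), true) +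
            (1 - (σ'.effort (θ, θ', t θ') * P.rate (t θ', θ) : unitInterval)) *
              c ((θ', w.2), false)))
        (μ.decisionRule (w.1, w.2, true) B) (μ.decisionRule (w.1, w.2, false) B)
          ∂(messageTest μ σ.report θ') ∂(σ'.report θ) := by
  rw [inducedSCF_apply _ _ _ _ hB]
  refine lintegral_congr fun θ' => ?_
  simp only [MarkovTransition.deterministic]
  rw [lintegral_dirac, lintegral_scoreMeasure, simulatedRule_apply _ _ _ _ hB,
    simulatedRule_apply _ _ _ _ hB, mix_lintegral]
  · refine lintegral_congr fun w => ?_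
    have hI : ∀ s, (σ.effort (θ', w) * c ((θ', w.2), s) : ℝ) ∈ unitInterval := fun s =>
      (σ.effort (θ', w) * c ((θ', w.2), s)).2
    rw [mix_mix (Subtype.prop _) (hI _) (hI _)]
    congr 1
    ring
  · refine UnivMeasurable.aemeasurable (univMeasurable_mix ?_
      (univMeasurable_decisionRule μ hB _)
      (univMeasurable_decisionRule μ hB _)) _
    exact ((σ.effort_univMeasurable.comp_measurable (by fun_prop)).mul_unitInterval
      (hc.comp_measurable (φ := fun w : M × T => ((θ', w.2), true))
        (by fun_prop))).coe_unitInterval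

end Simulation

/-! ### Deviations from a simulated profile -/

section Deviations

variable {Θ T M X : Type*} [MeasurableSpace Θ] [MeasurableSpace T] [MeasurableSpace M]
  [MeasurableSpace X] [MeasurableSpace.CountablyGenerated Θ] [MeasurableSpace.CountablyGenerated T]
  [MeasurableSpace.CountablyGenerated M] [MeasurableSpace.CountablyGenerated X]
  [MeasurableSingletonClass Θ] [MeasurableSingletonClass T] [MeasurableSingletonClass M]

/-- If no type can pass the simulated test more often than by taking that test with effort, then
whatever a type `θ` can achieve under a simulated rule, it can achieve in the original mechanism.
It reports as the type that it would have pretended to be, and exerts the conditional mean of the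
effort that this type's score would have reflected. -/
theorem exists_strategy_inducedSCF_eq (P : PassageRate T Θ) {t : Θ → T} (ht : Measurable t)
    (μ : Mechanism M T X) (σ : Strategy Θ M T) {c : (Θ × T) × Bool → unitInterval}
    (hc : UnivMeasurable c) {θ : Θ}
    (hmono : ∀ θ' ψ, c ((θ', ψ), false) ≤ c ((θ', ψ), true))
    (hdom : ∀ θ' ψ, (P.rate (t θ', θ) * c ((θ', ψ), true) +
      (1 - P.rate (t θ', θ)) * c ((θ', ψ), false) : ℝ) ≤ P.rate (ψ, θ))
    (σ' : Strategy Θ Θ T) :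
    ∃ σ'' : Strategy Θ M T, inducedSCF P μ σ'' θ =
      inducedSCF P ⟨.deterministic t ht, simulatedRule μ σ hc⟩ σ' θ := by
  let y : Θ → unitInterval := fun θ' => σ'.effort (θ, θ', t θ') * P.rate (t θ', θ)
  have hy : UnivMeasurable y :=
    (σ'.effort_univMeasurable.comp_measurable (by fun_prop)).mul_unitInterval
      (univMeasurable_of_measurable (P.measurable.comp
        (by fun_prop : Measurable fun θ' => (t θ', θ))))
  -- `s z` is the probability of a pass on the simulated test before effort is taken into account.
  let s : Θ × M × T → ℝ := fun z =>
    y z.1 * c ((z.1, z.2.2), true) + (1 - y z.1) * c ((z.1, z.2.2), false)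
  have hs0 : ∀ z, 0 ≤ s z := fun z => (mix_mem (y _).2 (c _).2 (c _).2).1
  have hsP : ∀ z, s z ≤ P.rate (z.2.2, θ) := fun z => by
    have h1 : (y z.1 : ℝ) ≤ P.rate (t z.1, θ) :=
      mul_le_of_le_one_left (P.rate _).2.1 (σ'.effort _).2.2
    have h2 := sub_nonneg.2 (Subtype.coe_le_coe.2 (hmono z.1 z.2.2))
    have h3 := mul_le_mul_of_nonneg_right h1 h2
    have h4 := hdom z.1 z.2.2
    simp only [s]
    linarith
  let π : M × T → unitInterval := fun w => P.rate (w.2, θ)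
  have hπ : UnivMeasurable π := univMeasurable_of_measurable (P.measurable.comp
    (by fun_prop : Measurable fun w : M × T => (w.2, θ)))
  let q : Θ × M × T → ℝ := fun z => σ.effort z * s z / π z.2
  have hqπ : ∀ z, q z * π z.2 = σ.effort z * s z := fun z => by
    rcases eq_or_ne (π z.2 : ℝ) 0 with h0 | h0
    · have : s z = 0 := le_antisymm ((hsP z).trans h0.le) (hs0 z)
      rw [this, h0, mul_zero, mul_zero]
    · exact div_mul_cancel₀ _ h0
  have hqI : ∀ z, q z ∈ unitInterval := fun z =>
    ⟨div_nonneg (mul_nonneg (σ.effort z).2.1 (hs0 z)) (π z.2).2.1,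
      div_le_one_of_le₀ ((mul_le_of_le_one_left (hs0 z) (σ.effort z).2.2).trans (hsP z))
        (π z.2).2.1⟩
  have hs : UnivMeasurable s := by
    have hy' : UnivMeasurable fun z : Θ × M × T => (y z.1 : ℝ) :=
      hy.coe_unitInterval.comp_measurable measurable_fst
    have hc' : ∀ b, UnivMeasurable fun z : Θ × M × T => (c ((z.1, z.2.2), b) : ℝ) := fun b =>
      hc.coe_unitInterval.comp_measurable (by fun_prop)
    exact (hy'.mul (hc' true)).add ((measurable_const.sub hy').mul (hc' false))
  have hes : UnivMeasurable fun z : Θ × M × T => σ.effort z * s z :=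
    σ.effort_univMeasurable.coe_unitInterval.mul hs
  have hq : UnivMeasurable q :=
    hes.div (hπ.coe_unitInterval.comp_measurable measurable_snd)
  let L := σ'.report.joint ((messageTest μ σ.report).comap Prod.snd measurable_snd)
  obtain ⟨a, ha, hmean⟩ := exists_measurable_conditional_mean (L θ) (hq.aemeasurable _) hqI
  have : IsProbabilityMeasure ((L θ).map Prod.snd) :=
    Measure.isProbabilityMeasure_map measurable_snd.aemeasurable
  let σ'' : Strategy Θ M T :=
    { report := σ'.report.andThen (σ.report.comap Prod.snd measurable_snd)
      effort := fun h => a h.2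
      effort_univMeasurable := univMeasurable_of_measurable (ha.comp measurable_snd) }
  -- The observed part of `L` is what the new report generates.
  have hmarg : ∀ h : M × T → ENNReal, UnivMeasurable h →
      ∫⁻ w, h w ∂(messageTest μ σ''.report θ) = ∫⁻ w, h w ∂((L θ).map Prod.snd) := by
    intro h hh
    have h1 : UnivMeasurable fun m => ∫⁻ ψ, h (m, ψ) ∂(μ.testingRule m) :=
      univMeasurable_lintegral _ hh
    have h2 : UnivMeasurable fun z : Θ × M × T => h z.2 := hh.comp_measurable measurable_snd
    rw [lintegral_map' (hh.aemeasurable _) measurable_snd.aemeasurable,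
      MarkovTransition.lintegral_joint _ _ h2, messageTest, MarkovTransition.lintegral_joint _ _ hh]
    refine (MarkovTransition.lintegral_andThen _ _ h1 θ).trans (lintegral_congr fun θ' => ?_)
    exact (MarkovTransition.lintegral_joint σ.report
      (μ.testingRule.comap Prod.snd measurable_snd) hh θ').symm
  refine ⟨σ'', Measure.ext fun B hB => ?_⟩
  rw [inducedSCF_simulatedRule_apply P ht μ σ hc σ' θ hB,
    inducedSCF_apply_eq_lintegral_messageTest P μ σ'' θ hB]
  let g : Bool → M × T → ENNReal := fun b w => μ.decisionRule (w.1, w.2, b) B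
  have hg : ∀ b, UnivMeasurable (g b) := univMeasurable_decisionRule μ hB
  have ha' : UnivMeasurable fun w : M × T => (a w * π w : ℝ) :=
    ((univMeasurable_of_measurable ha).mul_unitInterval hπ).coe_unitInterval
  have hfull : UnivMeasurable fun w => mix (π w) (g true w) (g false w) :=
    univMeasurable_mix hπ.coe_unitInterval (hg true) (hg false)
  calc ∫⁻ w, mix (a w * π w) (g true w) (g false w) ∂(messageTest μ σ''.report θ)
      = ∫⁻ w, mix (a w * π w) (g true w) (g false w) ∂((L θ).map Prod.snd) :=
        hmarg _ (univMeasurable_mix ha' (hg true) (hg false))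
    _ = ∫⁻ w, mix (a w) (mix (π w) (g true w) (g false w)) (g false w) ∂((L θ).map Prod.snd) :=
        lintegral_congr fun w => (mix_mix_right (a w).2 (π w).2 _ _).symm
    _ = ∫⁻ z, mix (q z) (mix (π z.2) (g true z.2) (g false z.2)) (g false z.2) ∂(L θ) :=
        hmean _ _ (hfull.aemeasurable _) ((hg false).aemeasurable _) fun w => prob_le_one
    _ = ∫⁻ z, mix (σ.effort z * s z) (g true z.2) (g false z.2) ∂(L θ) :=
        lintegral_congr fun z => by rw [mix_mix_right (hqI z) (π z.2).2, hqπ]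
    _ = ∫⁻ θ', ∫⁻ w, mix (σ.effort (θ', w) * s (θ', w)) (g true w) (g false w)
          ∂(messageTest μ σ.report θ') ∂(σ'.report θ) :=
        MarkovTransition.lintegral_joint _ _ (univMeasurable_mix hes
          ((hg true).comp_measurable measurable_snd)
          ((hg false).comp_measurable measurable_snd)) θ

/-- Under a simulated rule, truthful reporting with effort reproduces the original social choice
function, provided that the conversion takes the score of a truthful type on its own test to its
score on the simulated test. -/
theorem inducedSCF_simulatedRule_of_isCanonical (P : PassageRate T Θ) {t : Θ → T}
    (ht : Measurable t) (μ : Mechanism M T X) (σ : Strategy Θ M T)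
    {c : (Θ × T) × Bool → unitInterval} (hc : UnivMeasurable c)
    (heq : ∀ θ ψ, (P.rate (t θ, θ) * c ((θ, ψ), true) +
      (1 - P.rate (t θ, θ)) * c ((θ, ψ), false) : ℝ) = P.rate (ψ, θ))
    {σ' : Strategy Θ Θ T} (hσ' : IsCanonical σ') :
    inducedSCF P ⟨.deterministic t ht, simulatedRule μ σ hc⟩ σ' = inducedSCF P μ σ := by
  ext θ B hB
  rw [inducedSCF_simulatedRule_apply P ht μ σ hc σ' θ hB,
    inducedSCF_apply_eq_lintegral_messageTest P μ σ θ hB, hσ'.1]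
  simp only [MarkovTransition.deterministic, id_eq]
  rw [lintegral_dirac]
  refine lintegral_congr fun w => ?_
  rw [hσ'.2, one_mul, heq]

/-- A most discerning testing function canonically implements what any profile implements, by the
simulated rule for a universally measurable choice of conversions. -/
theorem MostDiscerning.canonicallyImplementableWith_of_implements
    [TopologicalSpace Θ] [PolishSpace Θ] [BorelSpace Θ]
    [TopologicalSpace T] [PolishSpace T] [BorelSpace T]
    {P : PassageRate T Θ} {t : Θ → T} (ht : Measurable t) (h : MostDiscerning P t)
    {U : Utility X Θ} {μ : Mechanism M T X} {σ : Strategy Θ M T} {f : MarkovTransition Θ X}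
    (hf : Implements P U μ σ f) :
    CanonicallyImplementableWith P U (.deterministic t ht) f := by
  obtain ⟨hIC, rfl⟩ := hf
  obtain ⟨a, b, ha, hb, hab⟩ := h.exists_univMeasurable_conversion ht
  let c : (Θ × T) × Bool → unitInterval := fun x => if x.2 = true then a x.1 else b x.1
  have hc : UnivMeasurable c := by
    have hset : MeasurableSet {x : (Θ × T) × Bool | x.2 = true} :=
      measurable_snd (measurableSet_singleton true)
    exact Measurable.ite (le_universalCompletion _ hset) (ha.comp_measurable measurable_fst)
      (hb.comp_measurable measurable_fst)
  let σ' : Strategy Θ Θ T :=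
    { report := .deterministic id measurable_id
      effort := fun _ => 1
      effort_univMeasurable := univMeasurable_of_measurable measurable_const }
  have hσ' : IsCanonical σ' := ⟨rfl, fun _ _ => rfl⟩
  have hind := inducedSCF_simulatedRule_of_isCanonical P ht μ σ hc
    (fun θ ψ => (hab θ ψ).2.1) hσ'
  refine ⟨simulatedRule μ σ hc, σ', hσ', fun τ θ => ?_, hind.symm⟩
  obtain ⟨σ'', hσ''⟩ := exists_strategy_inducedSCF_eq P ht μ σ hc
    (fun θ' ψ => (hab θ' ψ).1) (fun θ' ψ => (hab θ' ψ).2.2 θ) τ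
  rw [hind, ← hσ'']
  exact hIC σ'' θ

end Deviations

end MechTest

theorem mainTheorem1 {Θ : Type u} {T : Type v}
    [TopologicalSpace Θ] [PolishSpace Θ] [MeasurableSpace Θ] [BorelSpace Θ]
    [TopologicalSpace T] [PolishSpace T] [MeasurableSpace T] [BorelSpace T]
    (P : MechTest.PassageRate T Θ) (t : Θ → T) (ht : Measurable t) :
    MechTest.MostDiscerning P t ↔
      ∀ (X : Type u) [TopologicalSpace X] [PolishSpace X] [MeasurableSpace X] [BorelSpace X]
        (U : MechTest.Utility X Θ) (f : MechTest.MarkovTransition Θ X),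
        MechTest.Implementable P U f →
          MechTest.CanonicallyImplementableWith P U
            (MechTest.MarkovTransition.deterministic t ht) f := by
  refine ⟨fun h X _ _ _ _ U f hf => ?_, fun h => ?_⟩
  · obtain ⟨M, _, _, _, _, μ, σ, hfσ⟩ := hf
    exact h.canonicallyImplementableWith_of_implements ht hfσ
  · exact MechTest.mostDiscerning_of_forall_canonicallyImplementable P ht
      fun f hf => h (ULift.{u} Bool) (MechTest.passUtility Θ) f hf
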